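/- Let $\Bbbk$ be an algebraically closed field. A $\Bbbk$-linear additive category is finitary if it is idempotent complete, has finite-dimensional morphism spaces and only finitely many indecomposable objects up to isomorphism. A bicategory is quasi fiab if it has finitely many objects, its morphism categories are finitary, horizontal composition of $2$-morphisms is $\Bbbk$-bilinear, identity $1$-morphisms are indecomposable, and every $1$-morphism has a left and a right adjoint. On indecomposable $1$-morphisms, the left (resp. right) preorder is generated by $F\le G$ whenever $G$ is isomorphic to a direct summand of $HF$ (resp. $FH$) for some $1$-morphism $H$; left and right cells are the equivalence classes of these preorders, and $\mathcal H$-cells are the nonempty intersections of a left cell with a right cell. A $2$-ideal is a family of subspaces of the spaces of $2$-morphisms that is stable under vertical and horizontal composition with arbitrary $2$-morphisms. **Proposition.** Let $\mathcal C$ be a quasi fiab bicategory (for instance a quasi fiab $2$-category) with exactly one object $\bullet$ and exactly one $\mathcal H$-cell $\mathcal H_0$. If $\mathcal C$ is $\mathcal H_0$-simple, i.e. every nonzero $2$-ideal of $\mathcal C$ contains the identity $2$-morphisms of the $1$-morphisms in $\mathcal H_0$, then $\mathcal C$ is a fusion category. That is: $\mathcal C$ has only one object; $\mathcal C(\bullet,\bullet)$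 is a $\Bbbk$-linear additive category with finitely many isomorphism classes of indecomposable objects; it is semisimple (abelian, and every object is a finite direct sum of simple objects) and all its objects have finite length; its morphism spaces are finite-dimensional; horizontal composition is $\Bbbk$-bilinear on $2$-morphisms; the identity $1$-morphism $\mathbb 1_\bullet$ is indecomposable; and every $1$-morphism has a left and a right adjoint. -/

import Mathlib

open CategoryTheory CategoryTheory.Limits
open scoped Bicategory

universe w v u

attribute [local instance] CategoryTheory.Limits.hasBinaryBiproducts_of_finite_biproducts

/-- A `k`-linear additive category is finitary if it is idempotent complete, has finite-dimensional
morphism spaces and only finitely many indecomposable objects up to isomorphism. -/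
structure IsFinitaryCategory (k : Type*) [Field k] (C : Type*) [Category C] [Preadditive C]
    [Linear k C] [HasFiniteBiproducts C] : Prop where
  idempotentComplete : IsIdempotentComplete C
  finite_hom : ∀ X Y : C, Module.Finite k (X ⟶ Y)
  finite_indecomposables : ∃ (n : ℕ) (X : Fin n → C),
    ∀ Y : C, Indecomposable Y → ∃ i, Nonempty (Y ≅ X i)

/-- The category is semisimple: it is abelian (for the given additive structure) and every object
is a finite direct sum of simple objects. -/
structure IsSemisimpleCategory (C : Type*) [Category C] [P : Preadditive C]
    [HasFiniteBiproducts C] : Prop where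
  abelian : ∃ A : Abelian C, A.toPreadditive = P
  sum_of_simples : ∀ X : C, ∃ (n : ℕ) (S : Fin n → C),
    (∀ i, Simple (S i)) ∧ Nonempty (X ≅ ⨁ S)

section Bicategories

variable (k : Type*) [Field k] (B : Type u) [Bicategory.{w, v} B]
  [∀ a b : B, Preadditive (a ⟶ b)] [∀ a b : B, Linear k (a ⟶ b)]

/-- Horizontal composition of 2-morphisms is `k`-bilinear. (The horizontal composite of `η` and `θ`
is the vertical composite of a left and a right whiskering, and vertical composition is already
bilinear, so this says that both whiskerings are `k`-linear.) -/
structure HorizontalBilinear : Prop where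
  whiskerLeft_add : ∀ {a b c : B} (f : a ⟶ b) {g h : b ⟶ c} (η θ : g ⟶ h),
    f ◁ (η + θ) = f ◁ η + f ◁ θ
  whiskerLeft_smul : ∀ {a b c : B} (f : a ⟶ b) {g h : b ⟶ c} (r : k) (η : g ⟶ h),
    f ◁ (r • η) = r • (f ◁ η)
  add_whiskerRight : ∀ {a b c : B} {f g : a ⟶ b} (η θ : f ⟶ g) (h : b ⟶ c),
    (η + θ) ▷ h = η ▷ h + θ ▷ h
  smul_whiskerRight : ∀ {a b c : B} {f g : a ⟶ b} (r : k) (η : f ⟶ g) (h : b ⟶ c),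
    (r • η) ▷ h = r • (η ▷ h)

/-- A 2-ideal: a family of subspaces of the spaces of 2-morphisms that is stable under vertical and
horizontal composition, on both sides, with arbitrary 2-morphisms. -/
structure TwoIdeal where
  carrier : ∀ {a b : B} (f g : a ⟶ b), Submodule k (f ⟶ g)
  precomp_mem : ∀ {a b : B} {f g h : a ⟶ b} (η : f ⟶ g) {θ : g ⟶ h},
    θ ∈ carrier g h → η ≫ θ ∈ carrier f h
  postcomp_mem : ∀ {a b : B} {f g h : a ⟶ b} {η : f ⟶ g} (θ : g ⟶ h),
    η ∈ carrier f g → η ≫ θ ∈ carrier f h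
  whiskerLeft_mem : ∀ {a b c : B} (f : a ⟶ b) {g h : b ⟶ c} {η : g ⟶ h},
    η ∈ carrier g h → f ◁ η ∈ carrier (f ≫ g) (f ≫ h)
  whiskerRight_mem : ∀ {a b c : B} {f g : a ⟶ b} {η : f ⟶ g} (h : b ⟶ c),
    η ∈ carrier f g → η ▷ h ∈ carrier (f ≫ h) (g ≫ h)

variable {k B} in
/-- The 2-ideal is not the zero 2-ideal. -/
def TwoIdeal.IsNonzero (I : TwoIdeal k B) : Prop :=
  ∃ (a b : B) (f g : a ⟶ b) (η : f ⟶ g), η ∈ I.carrier f g ∧ η ≠ 0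

variable [∀ a b : B, HasFiniteBiproducts (a ⟶ b)]

/-- A bicategory with finitely many objects, finitary morphism categories and bilinear horizontal
composition. -/
structure IsMultifinitary : Prop where
  finite_objects : Finite B
  finitary_hom : ∀ a b : B, IsFinitaryCategory k (a ⟶ b)
  bilinear : HorizontalBilinear k B

/-- A multifinitary bicategory all of whose identity 1-morphisms are indecomposable. -/
structure IsFinitaryBicategory : Prop extends IsMultifinitary k B where
  indecomposable_id : ∀ a : B, Indecomposable (𝟙 a)

/-- A finitary bicategory in which each 1-morphism has a left and a right adjoint.
(`IsLeftAdjoint f` says that `f` is a left adjoint, i.e. has a right adjoint.) -/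
structure IsQuasiFiab : Prop extends IsFinitaryBicategory k B where
  hasRightAdjoint : ∀ {a b : B} (f : a ⟶ b), Bicategory.IsLeftAdjoint f
  hasLeftAdjoint : ∀ {a b : B} (f : a ⟶ b), Bicategory.IsRightAdjoint f

/-- A fusion category, viewed as a one-object bicategory. -/
structure IsFusion : Prop where
  one_object : Nonempty (Unique B)
  finite_indecomposables : ∀ a : B, ∃ (n : ℕ) (X : Fin n → (a ⟶ a)),
    ∀ Y : a ⟶ a, Indecomposable Y → ∃ i, Nonempty (Y ≅ X i)
  semisimple : ∀ a : B, IsSemisimpleCategory (a ⟶ a)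
  finite_length : ∀ (a : B) (X : a ⟶ a), IsNoetherianObject X ∧ IsArtinianObject X
  finite_hom : ∀ (a : B) (X Y : a ⟶ a), Module.Finite k (X ⟶ Y)
  bilinear : HorizontalBilinear k B
  indecomposable_id : ∀ a : B, Indecomposable (𝟙 a)
  hasRightAdjoint : ∀ (a : B) (X : a ⟶ a), Bicategory.IsLeftAdjoint X
  hasLeftAdjoint : ∀ (a : B) (X : a ⟶ a), Bicategory.IsRightAdjoint X

end Bicategories

section Cells

variable (B : Type u) [Bicategory.{w, v} B] [∀ a b : B, Preadditive (a ⟶ b)]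
  [∀ a b : B, HasFiniteBiproducts (a ⟶ b)]

/-- The indecomposable 1-morphisms of a bicategory. -/
structure IndecOneMor where
  {src : B}
  {tgt : B}
  hom : src ⟶ tgt
  indecomposable : Indecomposable hom

variable {B}

/-- `X` is isomorphic to a direct summand of `Y`. -/
def IsSummand {a b : B} (X Y : a ⟶ b) : Prop :=
  ∃ Z : a ⟶ b, Nonempty (Y ≅ X ⊞ Z)

/-- `F` and `G` start at the same object, and `G` is isomorphic to a direct summand of
`H ∘ F = F ≫ H` for some `H`. -/
inductive LeftGen : IndecOneMor B → IndecOneMor B → Prop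
  | mk {a b c : B} {F : a ⟶ b} {G : a ⟶ c} (hF : Indecomposable F) (hG : Indecomposable G)
      (H : b ⟶ c) (h : IsSummand G (F ≫ H)) : LeftGen ⟨F, hF⟩ ⟨G, hG⟩

/-- `F` and `G` end at the same object, and `G` is isomorphic to a direct summand of
`F ∘ H = H ≫ F` for some `H`. -/
inductive RightGen : IndecOneMor B → IndecOneMor B → Prop
  | mk {a b c : B} {F : b ⟶ c} {G : a ⟶ c} (hF : Indecomposable F) (hG : Indecomposable G)
      (H : a ⟶ b) (h : IsSummand G (H ≫ F)) : RightGen ⟨F, hF⟩ ⟨G, hG⟩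

/-- The left preorder on indecomposable 1-morphisms. -/
def LeftLE : IndecOneMor B → IndecOneMor B → Prop := Relation.ReflTransGen LeftGen

/-- The right preorder on indecomposable 1-morphisms. -/
def RightLE : IndecOneMor B → IndecOneMor B → Prop := Relation.ReflTransGen RightGen

/-- Left cells, as isomorphism-closed sets of indecomposable 1-morphisms. -/
def IsLeftCell (S : Set (IndecOneMor B)) : Prop :=
  ∃ F, S = {G | LeftLE F G ∧ LeftLE G F}

/-- Right cells, as isomorphism-closed sets of indecomposable 1-morphisms. -/
def IsRightCell (S : Set (IndecOneMor B)) : Prop :=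
  ∃ F, S = {G | RightLE F G ∧ RightLE G F}

/-- An `H`-cell is a (nonempty) intersection of a left cell and a right cell. -/
def IsHCell (S : Set (IndecOneMor B)) : Prop :=
  S.Nonempty ∧ ∃ L R, IsLeftCell L ∧ IsRightCell R ∧ S = L ∩ R

/-- The bicategory is `J`-simple: every nonzero 2-ideal contains the identity 2-morphisms of the
1-morphisms in `J`. -/
def IsCellSimple (k : Type*) [Field k] [∀ a b : B, Linear k (a ⟶ b)]
    (J : Set (IndecOneMor B)) : Prop :=
  ∀ I : TwoIdeal k B, I.IsNonzero → ∀ F ∈ J, 𝟙 F.hom ∈ I.carrier F.hom F.hom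

end Cells

/-!
Write `F i` for representatives of the isomorphism classes of indecomposable 1-morphisms. Because
the base field is algebraically closed, each `End (F i)` is local with residue field `k`
(`exists_residue_functional`), and the rank of the pairing `(a, b) ↦ a ≫ f ≫ b` with values in that
residue field is the multiplicity of `F i` in the largest object whose identity factors through `f`
(`IndecRepresentatives.rank`). The radical consists of the morphisms all of whose ranks vanish.

The point is that, when there is only one cell, the radical is a 2-ideal. Let `f` be radical and `H`
a 1-morphism, let `N i j` be the multiplicity of `F j` in `H ≫ F i`, and let `r i j` be the rank of
`F i ◁ f` at `F j`. The rank at `F i` of `H ◁ F i ◁ f` is the `i`-th diagonal entry of `N r`, as one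
sees by decomposing `H ≫ F i`; it is at least the `i`-th diagonal entry of `r N`, as one sees by
splitting off the non-radical part of `F i ◁ f`. Since `N r` and `r N` have the same trace, all the
inequalities are equalities (`IndecRepresentatives.rank_map_app_eq_zero`). For `F i ≅ 𝟙` the row
`r i` is zero because `f` is radical, so the identity of `𝟙` does not factor through `H ◁ f`, for
any `H`. As `𝟙` is a direct summand of `G ≫ F j` for some `G`, the identity of `F j` does not factor
through `H ◁ f` either, and `H ◁ f` is radical. The same holds on the other side.

The radical contains no identity of an indecomposable 1-morphism, so it vanishes by cell simplicity
(`radical_eq_bot_of_isCellSimple`). Then identities of indecomposables can be split off any morphism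
until nothing is left, so every morphism `f` has a generalized inverse `g` with `f ≫ g ≫ f = f`
(`IndecRepresentatives.exists_generalized_inverse`). With split idempotents this makes the category
abelian and semisimple, and it bounds the length of an object `X` by the dimension of `End X`.
-/

/-! ### Finite-dimensional algebras without nontrivial idempotents -/

/-- Fitting's lemma for elements: factoring `X * minpoly` as `X ^ n * q` with `q` prime to `X`
produces an idempotent in `k[a]`, which is `1` only if `a` is invertible and `0` only if `a` is
nilpotent. -/
theorem isUnit_or_isNilpotent_of_idempotents_trivial (k : Type*) {A : Type*} [Field k] [Ring A]
    [Algebra k A] [Module.Finite k A]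
    (hA : ∀ e : A, e * e = e → e = 0 ∨ e = 1) (a : A) : IsUnit a ∨ IsNilpotent a := by
  classical
  have hint : IsIntegral k a := IsIntegral.of_finite k a
  set p : Polynomial k := minpoly k a * Polynomial.X with hp
  have hp0 : p ≠ 0 := mul_ne_zero (minpoly.ne_zero hint) Polynomial.X_ne_zero
  have hpa : Polynomial.aeval a p = 0 := by simp [hp]
  have hroot : 0 < p.rootMultiplicity 0 :=
    (Polynomial.rootMultiplicity_pos hp0).2 (by simp [hp, Polynomial.IsRoot])
  obtain ⟨q, hq, hdvd⟩ := Polynomial.exists_eq_pow_rootMultiplicity_mul_and_not_dvd p hp0 0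
  rw [Polynomial.C_0, sub_zero] at hq hdvd
  set n := p.rootMultiplicity 0
  have hcop : IsCoprime (Polynomial.X ^ n) q :=
    ((Polynomial.irreducible_X.coprime_iff_not_dvd).2 hdvd).pow_left
  obtain ⟨u, w, huw⟩ := hcop
  have h1 : Polynomial.aeval a (u * Polynomial.X ^ n) + Polynomial.aeval a (w * q) = 1 := by
    rw [← map_add, huw, map_one]
  have h0 : Polynomial.aeval a (u * Polynomial.X ^ n) * Polynomial.aeval a (w * q) = 0 := by
    rw [← map_mul, show u * Polynomial.X ^ n * (w * q) = u * w * p by rw [hq]; ring, map_mul, hpa,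
      mul_zero]
  rcases hA (Polynomial.aeval a (u * Polynomial.X ^ n)) (by
    nth_rw 2 [eq_sub_of_add_eq h1]; rw [mul_sub, h0, mul_one, sub_zero]) with he | he
  · right
    refine ⟨n, ?_⟩
    rw [he, zero_add] at h1
    have : Polynomial.aeval a p * Polynomial.aeval a w = a ^ n := by
      rw [← map_mul, hq, show Polynomial.X ^ n * q * w = Polynomial.X ^ n * (w * q) by ring,
        map_mul, h1]
      simp
    rw [← this, hpa, zero_mul]
  · left
    obtain ⟨m, hm⟩ : ∃ m, n = m + 1 := ⟨n - 1, by omega⟩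
    have e1 : Polynomial.aeval a (u * Polynomial.X ^ m) * a = 1 := by
      rw [← he, hm, pow_succ, ← mul_assoc, map_mul _ _ Polynomial.X, Polynomial.aeval_X]
    have e2 : a * Polynomial.aeval a (u * Polynomial.X ^ m) = 1 := by
      rw [← he, hm, show u * Polynomial.X ^ (m + 1) = Polynomial.X * (u * Polynomial.X ^ m) by ring,
        map_mul _ Polynomial.X, Polynomial.aeval_X]
    exact ⟨⟨a, _, e2, e1⟩, rfl⟩

/-- A finite-dimensional algebra without nontrivial idempotents over an algebraically closed field
is local with residue field `k`; the functional is the projection onto the residue field. -/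
theorem exists_residue_functional {k A : Type*} [Field k] [Ring A] [Algebra k A]
    [Module.Finite k A] [IsAlgClosed k] [Nontrivial A]
    (hA : ∀ e : A, e * e = e → e = 0 ∨ e = 1) :
    ∃ χ : A →ₗ[k] k, χ 1 = 1 ∧ ∀ a, χ a ≠ 0 ↔ IsUnit a := by
  have : IsArtinianRing A := IsArtinianRing.of_finite k A
  have hmul (x y : A) (h : ¬ IsUnit y) : ¬ IsUnit (x * y) := fun hu => h (by
    obtain ⟨⟨c, d, h1, h2⟩, hc⟩ := hu
    simp only at hc
    have : d * x * y = 1 := by rw [mul_assoc, ← hc, h2]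
    exact IsUnit.of_mul_eq_one_right _ this)
  have hadd (x y : A) (hx : ¬ IsUnit x) (hy : ¬ IsUnit y) : ¬ IsUnit (x + y) := by
    rintro ⟨c, hc⟩
    have h1 : (↑c⁻¹ : A) * x + ↑c⁻¹ * y = 1 := by rw [← mul_add, ← hc, Units.inv_mul]
    have h2 := (isUnit_or_isNilpotent_of_idempotents_trivial k hA
      ((↑c⁻¹ : A) * x)).resolve_left (hmul _ _ hx)
    exact hmul _ _ hy (by rw [eq_sub_of_add_eq' h1]; exact h2.isUnit_one_sub)
  let N : Submodule k A :=
    { carrier := {a | ¬ IsUnit a}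
      add_mem' := fun {x y} hx hy => hadd x y hx hy
      zero_mem' := not_isUnit_zero
      smul_mem' := fun c x hx => by
        show ¬ IsUnit (c • x)
        rw [Algebra.smul_def]
        exact hmul _ _ hx }
  have hN (a : A) : a ∈ N ↔ ¬ IsUnit a := Iff.rfl
  have h1N : (1 : A) ∉ N := fun h => h isUnit_one
  obtain ⟨χ, hχ1, hχN⟩ := Submodule.exists_le_ker_of_notMem h1N
  have hχ1' : χ 1 ≠ 0 := hχ1
  refine ⟨(χ 1)⁻¹ • χ, by simp [hχ1'], fun a => ?_⟩
  have hz (x : A) (hx : ¬ IsUnit x) : χ x = 0 := hχN hx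
  -- an eigenvalue `c` of `a`: then `a - c` is not invertible, so `χ a = c * χ 1`
  obtain ⟨c, hc⟩ := spectrum.nonempty_of_isAlgClosed_of_finiteDimensional k a
  have hca : χ a = c * χ 1 := by
    have := hz _ ((spectrum.mem_iff).1 hc)
    rw [map_sub, Algebra.algebraMap_eq_smul_one, map_smul, sub_eq_zero] at this
    simpa using this.symm
  constructor
  · intro h
    by_contra hu
    exact h (by simp [hz a hu])
  · intro hu h
    have hc0 : c = 0 := by
      rw [LinearMap.smul_apply, hca] at h
      simpa [hχ1'] using h
    rw [spectrum.mem_iff, hc0, map_zero, zero_sub] at hc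
    exact hc hu.neg

/-! ### Indecomposable objects of finitary categories -/

section Indecomposables

variable {C : Type*} [Category C] [Preadditive C] [HasFiniteBiproducts C]

theorem CategoryTheory.Indecomposable.eq_zero_or_eq_id [IsIdempotentComplete C] {X : C}
    (hX : Indecomposable X) (e : X ⟶ X) (he : e ≫ e = e) : e = 0 ∨ e = 𝟙 X := by
  obtain ⟨Y, i, r, hir, hri⟩ := IsIdempotentComplete.idempotents_split X e he
  obtain ⟨Z, j, s, hjs, hsj⟩ :=
    IsIdempotentComplete.idempotents_split X (𝟙 X - e) (Idempotents.idem_of_id_sub_idem e he)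
  have his : i ≫ s = 0 := by
    have : i ≫ (s ≫ j) ≫ s = 0 := by
      rw [hsj, ← hri]; simp [reassoc_of% hir]
    simpa [hjs] using this
  have hjr : j ≫ r = 0 := by
    have : j ≫ (s ≫ j) ≫ r = 0 := by
      rw [hsj, ← hri]; simp [hir]
    simpa [reassoc_of% hjs] using this
  rcases hX.2 Y Z
    { hom := biprod.lift r s
      inv := biprod.desc i j
      hom_inv_id := by simp [hri, hsj]
      inv_hom_id := by ext <;> simp [hir, hjs, his, hjr] } with h | h
  · left
    rw [← hri, h.eq_of_src i 0, comp_zero]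
  · right
    rw [h.eq_of_src j 0, comp_zero] at hsj
    exact (sub_eq_zero.1 hsj.symm).symm

theorem CategoryTheory.Indecomposable.of_iso [IsIdempotentComplete C] {X Y : C}
    (hX : Indecomposable X) (φ : X ≅ Y) : Indecomposable Y :=
  ⟨fun h => hX.1 (h.of_iso φ), fun _ _ ψ => hX.2 _ _ (φ ≪≫ ψ)⟩

theorem CategoryTheory.Indecomposable.isIso_of_retract [IsIdempotentComplete C] {S X : C}
    (hX : Indecomposable X) (hS : ¬ IsZero S) {a : S ⟶ X} {b : X ⟶ S} (hab : a ≫ b = 𝟙 S) :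
    IsIso a := by
  rcases hX.eq_zero_or_eq_id (b ≫ a) (by simp [reassoc_of% hab]) with h | h
  · exfalso
    apply hS
    rw [IsZero.iff_id_eq_zero]
    have := a ≫= h =≫ b
    simpa [hab] using this
  · exact ⟨b, hab, h⟩

variable (k : Type*) [Field k] [Linear k C]

/-- By induction on `dim End X`, which drops when `X` is replaced by a proper direct summand. -/
theorem exists_indecomposable_retract [∀ X Y : C, Module.Finite k (X ⟶ Y)]
    {X : C} (hX : ¬ IsZero X) :
    ∃ (S : C) (a : S ⟶ X) (b : X ⟶ S), Indecomposable S ∧ a ≫ b = 𝟙 S := by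
  induction hn : Module.finrank k (X ⟶ X) using Nat.strong_induction_on generalizing X with
  | _ n ih =>
  by_cases hind : Indecomposable X
  · exact ⟨X, 𝟙 X, 𝟙 X, hind, by simp⟩
  obtain ⟨Y, Z, φ, hY, hZ⟩ : ∃ (Y Z : C) (_ : X ≅ Y ⊞ Z), ¬ IsZero Y ∧ ¬ IsZero Z := by
    by_contra hcon
    push Not at hcon
    exact hind ⟨hX, fun Y Z φ => or_iff_not_imp_left.2 (hcon Y Z φ)⟩
  let i : Y ⟶ X := biprod.inl ≫ φ.inv
  let r : X ⟶ Y := φ.hom ≫ biprod.fst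
  have hir : i ≫ r = 𝟙 Y := by simp [i, r]
  let T : (Y ⟶ Y) →ₗ[k] (X ⟶ X) := Linear.rightComp k X i ∘ₗ Linear.leftComp k Y r
  have hT (h : Y ⟶ Y) : T h = (r ≫ h) ≫ i := rfl
  have hinj : Function.Injective T := by
    intro g h hgh
    have := i ≫= hgh =≫ r
    simpa [hT, hir, reassoc_of% hir] using this
  have htop : LinearMap.range T ≠ ⊤ := by
    intro htop
    obtain ⟨h, hh⟩ : 𝟙 X ∈ LinearMap.range T := htop ▸ Submodule.mem_top
    apply hZ
    rw [IsZero.iff_id_eq_zero]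
    have := biprod.inr ≫= φ.inv ≫= hh =≫ (φ.hom ≫ biprod.snd)
    simpa [hT, i, r] using this.symm
  have hlt : Module.finrank k (Y ⟶ Y) < n := by
    rw [← LinearMap.finrank_range_of_inj hinj, ← hn]
    exact Submodule.finrank_lt htop
  obtain ⟨S, a, b, hS, hab⟩ := ih _ hlt hY rfl
  exact ⟨S, a ≫ i, r ≫ b, hS, by simp [reassoc_of% hir, hab]⟩

theorem CategoryTheory.Indecomposable.exists_residue [IsAlgClosed k] [IsIdempotentComplete C]
    {X : C} [Module.Finite k (X ⟶ X)] (hX : Indecomposable X) :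
    ∃ χ : (X ⟶ X) →ₗ[k] k, χ (𝟙 X) = 1 ∧ ∀ f, χ f ≠ 0 ↔ IsIso f := by
  have : Module.Finite k (End X) := ‹Module.Finite k (X ⟶ X)›
  have : Nontrivial (End X) :=
    ⟨⟨0, 1, fun h => hX.1 ((IsZero.iff_id_eq_zero X).2 h.symm)⟩⟩
  obtain ⟨χ, h1, h2⟩ := exists_residue_functional (k := k) (A := End X)
    fun e he => hX.eq_zero_or_eq_id e he
  exact ⟨χ, h1, fun f => (h2 f).trans (isUnit_iff_isIso f)⟩

/-- Representatives of the isomorphism classes of indecomposable objects, each with a linear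
functional on its endomorphism ring that vanishes exactly on the non-isomorphisms, that is, the
projection onto the residue field. -/
structure IndecRepresentatives (C : Type*) [Category C] [Preadditive C] [HasFiniteBiproducts C]
    [Linear k C] where
  /-- The set of isomorphism classes. -/
  ι : Type
  [fintype : Fintype ι]
  [decEq : DecidableEq ι]
  /-- The representatives. -/
  obj : ι → C
  indecomposable : ∀ i, Indecomposable (obj i)
  eq_of_iso : ∀ {i j}, (obj i ≅ obj j) → i = j
  exists_iso : ∀ Y : C, Indecomposable Y → ∃ i, Nonempty (Y ≅ obj i)
  /-- The residue functionals. -/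
  χ : ∀ i, (obj i ⟶ obj i) →ₗ[k] k
  χ_id : ∀ i, χ i (𝟙 _) = 1
  χ_ne_zero_iff : ∀ {i} (f : obj i ⟶ obj i), χ i f ≠ 0 ↔ IsIso f

attribute [instance] IndecRepresentatives.fintype IndecRepresentatives.decEq

theorem IsFinitaryCategory.nonempty_indecRepresentatives [IsAlgClosed k]
    (h : IsFinitaryCategory k C) : Nonempty (IndecRepresentatives k C) := by
  classical
  have := h.idempotentComplete
  have := h.finite_hom
  obtain ⟨n, X, hX⟩ := h.finite_indecomposables
  let s : Setoid {i : Fin n // Indecomposable (X i)} :=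
    { r := fun i j => Nonempty (X i ≅ X j)
      iseqv := ⟨fun _ => ⟨Iso.refl _⟩, fun ⟨e⟩ => ⟨e.symm⟩, fun ⟨e⟩ ⟨f⟩ => ⟨e ≪≫ f⟩⟩ }
  choose χ hχ1 hχ2 using fun i : Quotient s => (i.out.2).exists_residue k
  exact ⟨
    { ι := Quotient s
      obj := fun i => X i.out
      indecomposable := fun i => i.out.2
      eq_of_iso := fun e => Quotient.out_equiv_out.1 ⟨e⟩
      exists_iso := fun Y hY => by
        obtain ⟨i, ⟨e⟩⟩ := hX Y hY
        obtain ⟨f⟩ : Nonempty (X _ ≅ X _) := s.symm (Quotient.mk_out (s := s) ⟨i, hY.of_iso e⟩)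
        exact ⟨_, ⟨e ≪≫ f⟩⟩
      χ := χ
      χ_id := hχ1
      χ_ne_zero_iff := fun {i} f => hχ2 i f }⟩

end Indecomposables

/-! ### Rank functions -/

section RankFunctions

variable {C : Type*} [Category C] [Preadditive C]

/-- A numerical invariant of morphisms that does not increase under composition and is additive
along the decompositions `f = e ≫ f + (𝟙 - e) ≫ f` in which the idempotent `e` of the source is
intertwined by `f` with an idempotent of the target. -/
structure IsRankFunction (ρ : ∀ ⦃X Y : C⦄, (X ⟶ Y) → ℕ) : Prop where
  comp_le : ∀ {W X Y Z : C} (a : W ⟶ X) (f : X ⟶ Y) (b : Y ⟶ Z), ρ (a ≫ f ≫ b) ≤ ρ f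
  add : ∀ {X Y : C} (f : X ⟶ Y) (e : X ⟶ X) (e' : Y ⟶ Y), e ≫ e = e → e' ≫ e' = e' →
    e ≫ f = f ≫ e' → ρ f = ρ (e ≫ f) + ρ ((𝟙 X - e) ≫ f)

namespace IsRankFunction

variable {ρ : ∀ ⦃X Y : C⦄, (X ⟶ Y) → ℕ}

theorem zero {X Y : C} (hρ : IsRankFunction ρ) : ρ (0 : X ⟶ Y) = 0 := by
  simpa using hρ.add (0 : X ⟶ Y) 0 0 (by simp) (by simp) (by simp)

/-- Splitting off a retract `S` of the morphism `g`: the remainder `g - g ≫ b ≫ a ≫ g` is `g` cut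
down by the idempotent complementary to `g ≫ b ≫ a`. -/
theorem eq_add_of_retract (hρ : IsRankFunction ρ) {S X Y : C} {g : X ⟶ Y} {a : S ⟶ X} {b : Y ⟶ S}
    (h : a ≫ g ≫ b = 𝟙 S) : ρ g = ρ (𝟙 S) + ρ (g - g ≫ b ≫ a ≫ g) := by
  rw [hρ.add g (g ≫ b ≫ a) (b ≫ a ≫ g) (by simp [reassoc_of% h]) (by simp [reassoc_of% h])
    (by simp)]
  congr 1
  · apply le_antisymm
    · simpa using hρ.comp_le (g ≫ b) (𝟙 S) (a ≫ g)
    · have := hρ.comp_le a ((g ≫ b ≫ a) ≫ g) b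
      simpa [reassoc_of% h, h] using this
  · simp [Preadditive.sub_comp]

theorem eq_of_iso (hρ : IsRankFunction ρ) {X Y X' Y' : C} (α : X ≅ X') (β : Y ≅ Y') (f : X ⟶ Y)
    (g : X' ⟶ Y') (h : f ≫ β.hom = α.hom ≫ g) : ρ f = ρ g := by
  apply le_antisymm
  · rw [show f = α.hom ≫ g ≫ β.inv by rw [← reassoc_of% h]; simp]
    exact hρ.comp_le _ _ _
  · rw [show g = α.inv ≫ f ≫ β.hom by rw [h]; simp]
    exact hρ.comp_le _ _ _

end IsRankFunction

/-- Removing a retract of an idempotent leaves an idempotent. -/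
theorem idempotent_sub_retract {S X : C} {g : X ⟶ X} (hg : g ≫ g = g) {a : S ⟶ X} {b : X ⟶ S}
    (h : a ≫ g ≫ b = 𝟙 S) :
    (g - g ≫ b ≫ a ≫ g) ≫ (g - g ≫ b ≫ a ≫ g) = g - g ≫ b ≫ a ≫ g := by
  simp [Preadditive.sub_comp, hg, reassoc_of% hg, reassoc_of% h]

/-- The rank of the action of an additive functor on morphisms. -/
theorem IsRankFunction.map {D : Type*} [Category D] [Preadditive D]
    {ρ : ∀ ⦃X Y : D⦄, (X ⟶ Y) → ℕ} (hρ : IsRankFunction ρ) (L : C ⥤ D) [L.Additive] :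
    IsRankFunction fun (X Y : C) (f : X ⟶ Y) => ρ (L.map f) where
  comp_le a f b := by simpa using hρ.comp_le (L.map a) (L.map f) (L.map b)
  add f e e' he he' h := by
    simpa [L.map_sub] using hρ.add (L.map f) (L.map e) (L.map e') (by rw [← L.map_comp, he])
      (by rw [← L.map_comp, he']) (by rw [← L.map_comp, h, L.map_comp])

/-- For a natural transformation `τ` of additive functors, the rank of the diagonal of the
naturality square of `τ` at a morphism is again a rank function of that morphism. -/
theorem IsRankFunction.map_comp_app {D : Type*} [Category D] [Preadditive D]
    {ρ : ∀ ⦃X Y : D⦄, (X ⟶ Y) → ℕ} (hρ : IsRankFunction ρ) {P Q : C ⥤ D} [P.Additive] [Q.Additive]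
    (τ : P ⟶ Q) : IsRankFunction fun (X Y : C) (f : X ⟶ Y) => ρ (P.map f ≫ τ.app Y) where
  comp_le a f b := by simpa using hρ.comp_le (P.map a) (P.map f ≫ τ.app _) (Q.map b)
  add f e e' he he' h := by
    have := hρ.add (P.map f ≫ τ.app _) (P.map e) (Q.map e') (by rw [← P.map_comp, he])
      (by rw [← Q.map_comp, he'])
      (by rw [← P.map_comp_assoc, h, P.map_comp, Category.assoc, τ.naturality, Category.assoc])
    simpa [P.map_sub] using this

variable {k : Type*} [Field k] [Linear k C]

/-- The bilinear pairing `(a, b) ↦ χ (a ≫ f ≫ b)` attached to a functional `χ` on `End S`. -/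
def morphismPairing {S : C} (χ : (S ⟶ S) →ₗ[k] k) {X Y : C} (f : X ⟶ Y) :
    (S ⟶ X) →ₗ[k] Module.Dual k (Y ⟶ S) :=
  LinearMap.mk₂ k (fun a b => χ (a ≫ f ≫ b)) (by simp) (by simp) (by simp) (by simp)

theorem morphismPairing_apply {S : C} (χ : (S ⟶ S) →ₗ[k] k) {X Y : C} (f : X ⟶ Y) (a : S ⟶ X)
    (b : Y ⟶ S) : morphismPairing χ f a b = χ (a ≫ f ≫ b) := rfl

/-- The rank of `morphismPairing`. When `S` is indecomposable and `χ` is the residue functional,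
this is the multiplicity of `S` in the largest object whose identity factors through `f`. -/
noncomputable def pairingRank {S : C} (χ : (S ⟶ S) →ₗ[k] k) ⦃X Y : C⦄ (f : X ⟶ Y) : ℕ :=
  Module.finrank k (LinearMap.range (morphismPairing χ f))

theorem isRankFunction_pairingRank [∀ X Y : C, Module.Finite k (X ⟶ Y)] {S : C}
    (χ : (S ⟶ S) →ₗ[k] k) : IsRankFunction (pairingRank χ) where
  comp_le {W X Y Z} a f b := by
    have : morphismPairing χ (a ≫ f ≫ b) =
        (Module.Dual.transpose (Linear.leftComp k S b) ∘ₗ morphismPairing χ f) ∘ₗ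
          Linear.rightComp k S a := by
      ext p q
      simp [morphismPairing_apply, Module.Dual.transpose_apply]
    unfold pairingRank
    rw [this]
    refine (Submodule.finrank_mono (LinearMap.range_comp_le_range _ _)).trans ?_
    rw [LinearMap.range_comp]
    exact Submodule.finrank_map_le _ _
  add {X Y} f e e' he he' h := by
    have h' : (𝟙 X - e) ≫ f = f ≫ (𝟙 Y - e') := by simp [Preadditive.sub_comp, h]
    have hsum : LinearMap.range (morphismPairing χ f) =
        LinearMap.range (morphismPairing χ (e ≫ f)) ⊔
          LinearMap.range (morphismPairing χ ((𝟙 X - e) ≫ f)) := by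
      apply le_antisymm
      · rintro _ ⟨a, rfl⟩
        refine Submodule.mem_sup.2 ⟨_, ⟨a, rfl⟩, _, ⟨a, rfl⟩, ?_⟩
        ext b
        simp [morphismPairing_apply, Preadditive.sub_comp]
      · refine sup_le ?_ ?_
        · rintro _ ⟨a, rfl⟩
          exact ⟨a ≫ e, by ext b; simp [morphismPairing_apply]⟩
        · rintro _ ⟨a, rfl⟩
          exact ⟨a ≫ (𝟙 X - e), by ext b; simp [morphismPairing_apply]⟩
    have hinf : LinearMap.range (morphismPairing χ (e ≫ f)) ⊓
        LinearMap.range (morphismPairing χ ((𝟙 X - e) ≫ f)) = ⊥ := by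
      rw [eq_bot_iff]
      rintro _ ⟨⟨a, rfl⟩, ⟨a', ha'⟩⟩
      rw [Submodule.mem_bot]
      ext b
      -- evaluating at `e' ≫ b` fixes the first kind of functional and kills the second
      have h1 : morphismPairing χ (e ≫ f) a (e' ≫ b) = morphismPairing χ (e ≫ f) a b := by
        simp [morphismPairing_apply, h, reassoc_of% he']
      have h2 : morphismPairing χ ((𝟙 X - e) ≫ f) a' (e' ≫ b) = 0 := by
        rw [morphismPairing_apply, h']
        simp [Preadditive.sub_comp, reassoc_of% he']
      rw [← h1, ← ha', h2, LinearMap.zero_apply]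
    unfold pairingRank
    rw [hsum, ← Submodule.finrank_sup_add_finrank_inf_eq, hinf, finrank_bot, add_zero]

end RankFunctions

namespace IndecRepresentatives

variable {k : Type*} [Field k] {C : Type*} [Category C] [Preadditive C] [HasFiniteBiproducts C]
  [Linear k C] (R : IndecRepresentatives k C)

/-- The multiplicity of the `i`-th indecomposable object in the non-radical part of `f`. -/
noncomputable def rank (i : R.ι) ⦃X Y : C⦄ (f : X ⟶ Y) : ℕ := pairingRank (R.χ i) f

theorem exists_factor {i : R.ι} {X Y : C} {f : X ⟶ Y} (h : R.rank i f ≠ 0) :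
    ∃ (a : R.obj i ⟶ X) (b : Y ⟶ R.obj i), a ≫ f ≫ b = 𝟙 _ := by
  obtain ⟨a, b, hab⟩ : ∃ a b, morphismPairing (R.χ i) f a b ≠ 0 := by
    by_contra hcon
    push Not at hcon
    have h0 : morphismPairing (R.χ i) f = 0 := by ext a b; exact hcon a b
    apply h
    rw [rank, pairingRank, h0, LinearMap.range_zero, finrank_bot]
  rw [morphismPairing_apply, R.χ_ne_zero_iff] at hab
  exact ⟨a, b ≫ inv (a ≫ f ≫ b), by
    simpa only [Category.assoc] using IsIso.hom_inv_id (a ≫ f ≫ b)⟩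

variable [∀ X Y : C, Module.Finite k (X ⟶ Y)]

theorem isRankFunction_rank (i : R.ι) : IsRankFunction (R.rank i) :=
  isRankFunction_pairingRank _

/-- The pairing on `End (R.obj i)` has rank one because the non-isomorphisms form an ideal of
codimension one. -/
theorem rank_id_obj_self (i : R.ι) : R.rank i (𝟙 (R.obj i)) = 1 := by
  have hnu (f : R.obj i ⟶ R.obj i) : R.χ i f = 0 ↔ ¬ IsIso f := by
    rw [← R.χ_ne_zero_iff, not_not]
  have hspan : LinearMap.range (morphismPairing (R.χ i) (𝟙 (R.obj i))) =
      Submodule.span k {morphismPairing (R.χ i) (𝟙 (R.obj i)) (𝟙 _)} := by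
    apply le_antisymm
    · rintro _ ⟨a, rfl⟩
      refine Submodule.mem_span_singleton.2 ⟨R.χ i a, ?_⟩
      ext b
      -- `a - χ a` is not invertible, hence neither is its composite with `b`
      have h1 : R.χ i ((a - R.χ i a • 𝟙 _) ≫ b) = 0 := by
        rw [hnu]
        intro hiso
        have h2 : ¬ IsIso (a - R.χ i a • 𝟙 (R.obj i)) := by
          rw [← hnu, map_sub, map_smul, R.χ_id]; simp
        apply h2
        have : Module.Finite k (End (R.obj i)) :=
          inferInstanceAs (Module.Finite k (R.obj i ⟶ R.obj i))
        have : IsArtinianRing (End (R.obj i)) := IsArtinianRing.of_finite k _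
        rw [← isUnit_iff_isIso] at hiso ⊢
        exact isUnit_of_mul_isUnit_right hiso
      rw [Preadditive.sub_comp, map_sub, sub_eq_zero] at h1
      simpa [morphismPairing_apply] using h1.symm
    · rw [Submodule.span_singleton_le_iff_mem]
      exact ⟨_, rfl⟩
  rw [rank, pairingRank, hspan, finrank_span_singleton]
  intro h0
  have := LinearMap.congr_fun h0 (𝟙 (R.obj i))
  rw [morphismPairing_apply, Category.id_comp, Category.id_comp, R.χ_id] at this
  simp at this

theorem rank_ne_zero_of_factor {i : R.ι} {X Y : C} {f : X ⟶ Y} {a : R.obj i ⟶ X} {b : Y ⟶ R.obj i}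
    (h : a ≫ f ≫ b = 𝟙 _) : R.rank i f ≠ 0 := by
  have := (R.isRankFunction_rank i).comp_le a f b
  rw [h, R.rank_id_obj_self] at this
  omega

theorem exists_factor_of_indecomposable {S X Y : C} (hS : Indecomposable S) {f : X ⟶ Y}
    {a : S ⟶ X} {b : Y ⟶ S} (h : a ≫ f ≫ b = 𝟙 S) : ∃ i, R.rank i f ≠ 0 := by
  obtain ⟨i, ⟨e⟩⟩ := R.exists_iso S hS
  exact ⟨i, R.rank_ne_zero_of_factor (a := e.inv ≫ a) (b := b ≫ e.hom) (by
    simp [reassoc_of% h])⟩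

theorem rank_eq_zero_iff {i : R.ι} {X Y : C} {f : X ⟶ Y} :
    R.rank i f = 0 ↔ ∀ a b, R.χ i (a ≫ f ≫ b) = 0 := by
  rw [rank, pairingRank, Submodule.finrank_eq_zero, LinearMap.range_eq_bot]
  exact ⟨fun h a b => by rw [← morphismPairing_apply, h]; rfl, fun h => by ext a b; exact h a b⟩

/-- The radical of the category: the morphisms through which no identity of an indecomposable
object factors, encoded as the morphisms of rank zero at every indecomposable. -/
def radical (X Y : C) : Submodule k (X ⟶ Y) where
  carrier := {f | ∀ i, R.rank i f = 0}
  add_mem' {f g} hf hg i := by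
    have hf' := R.rank_eq_zero_iff.1 (hf i)
    have hg' := R.rank_eq_zero_iff.1 (hg i)
    exact R.rank_eq_zero_iff.2 fun a b => by simp [hf', hg']
  zero_mem' i := (R.isRankFunction_rank i).zero
  smul_mem' c f hf i := by
    have hf' := R.rank_eq_zero_iff.1 (hf i)
    exact R.rank_eq_zero_iff.2 fun a b => by simp [hf']

theorem comp_mem_radical {W X Y Z : C} (a : W ⟶ X) {f : X ⟶ Y} (b : Y ⟶ Z)
    (hf : f ∈ R.radical X Y) : a ≫ f ≫ b ∈ R.radical W Z := fun i =>
  Nat.le_zero.1 (((R.isRankFunction_rank i).comp_le a f b).trans (hf i).le)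

variable [IsIdempotentComplete C]

theorem rank_id_obj (i j : R.ι) : R.rank i (𝟙 (R.obj j)) = if i = j then 1 else 0 := by
  split_ifs with hij
  · subst hij
    exact R.rank_id_obj_self i
  · by_contra h
    obtain ⟨a, b, hab⟩ := R.exists_factor h
    rw [Category.id_comp] at hab
    have := (R.indecomposable j).isIso_of_retract (R.indecomposable i).1 hab
    exact hij (R.eq_of_iso (asIso a))

/-- A nonzero idempotent is not in the radical. -/
theorem exists_rank_ne_zero {X : C} {e : X ⟶ X} (he : e ≫ e = e) (h0 : e ≠ 0) :
    ∃ i, R.rank i e ≠ 0 := by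
  obtain ⟨Y, i, r, hir, hri⟩ := IsIdempotentComplete.idempotents_split X e he
  have hY : ¬ IsZero Y := fun hY => h0 (by rw [← hri, hY.eq_of_src i 0, comp_zero])
  obtain ⟨S, a, b, hS, hab⟩ := exists_indecomposable_retract k hY
  refine R.exists_factor_of_indecomposable hS (a := a ≫ i) (b := r ≫ b) ?_
  simp [← hri, reassoc_of% hir, hab]

/-- Splitting off an indecomposable retract lowers exactly one rank, and that by one; the weights
`c` allow for the weighted sums below. -/
theorem sum_rank_eq_succ {j : R.ι} {X Y : C} {g : X ⟶ Y} {a : R.obj j ⟶ X} {b : Y ⟶ R.obj j}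
    (h : a ≫ g ≫ b = 𝟙 _) (c : R.ι → ℕ) :
    ∑ i, R.rank i g * c i = c j + ∑ i, R.rank i (g - g ≫ b ≫ a ≫ g) * c i := by
  simp_rw [fun i => (R.isRankFunction_rank i).eq_add_of_retract h, rank_id_obj, add_mul,
    Finset.sum_add_distrib]
  simp

variable {ρ : ∀ ⦃X Y : C⦄, (X ⟶ Y) → ℕ}

/-- The contribution of the non-radical part of `g` to its rank. -/
theorem sum_rank_mul_le (hρ : IsRankFunction ρ) {X Y : C} (g : X ⟶ Y) :
    ∑ j, R.rank j g * ρ (𝟙 (R.obj j)) ≤ ρ g := by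
  induction hn : ∑ j, R.rank j g * 1 using Nat.strong_induction_on generalizing g with
  | _ n ih =>
  by_cases h0 : ∃ j, R.rank j g ≠ 0
  · obtain ⟨j, hj⟩ := h0
    obtain ⟨a, b, hab⟩ := R.exists_factor hj
    rw [R.sum_rank_eq_succ hab] at hn
    rw [R.sum_rank_eq_succ hab, hρ.eq_add_of_retract hab]
    exact Nat.add_le_add_left (ih _ (by omega) _ rfl) _
  · push Not at h0
    simp [h0]

/-- A rank function is determined on idempotents by its values on the identities of the
indecomposable objects. -/
theorem sum_rank_mul_eq (hρ : IsRankFunction ρ) {X : C} (g : X ⟶ X) (hg : g ≫ g = g) :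
    ρ g = ∑ j, R.rank j g * ρ (𝟙 (R.obj j)) := by
  induction hn : ∑ j, R.rank j g * 1 using Nat.strong_induction_on generalizing g with
  | _ n ih =>
  by_cases h0 : ∃ j, R.rank j g ≠ 0
  · obtain ⟨j, hj⟩ := h0
    obtain ⟨a, b, hab⟩ := R.exists_factor hj
    rw [R.sum_rank_eq_succ hab] at hn
    rw [R.sum_rank_eq_succ hab, hρ.eq_add_of_retract hab]
    rw [ih _ (by omega) _ (idempotent_sub_retract hg hab) rfl]
  · have hg0 : g = 0 := by
      by_contra hne
      exact h0 (R.exists_rank_ne_zero hg hne)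
    push Not at h0
    simp_rw [h0]
    simp [hg0, hρ.zero]

/-- Let `N l j` be the multiplicity of the `j`-th indecomposable in the image under `L` of the
`l`-th, and let `r l j` be the rank at `j` of the value of `τ` at the `l`-th. Computing the rank at
`l` of `L.map (τ.app (R.obj l))` in two ways gives `(N r) l l ≥ (r N) l l`, and both products have
the same trace; hence their diagonals agree. So if `τ.app (R.obj i)` is radical, then `R.obj i` does
not occur in `L.map (τ.app (R.obj i))`. -/
theorem rank_map_app_eq_zero (L : C ⥤ C) [L.Additive] {P Q : C ⥤ C} [P.Additive] [Q.Additive]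
    (τ : P ⟶ Q) (hLτ : ∀ i X, R.rank i (L.map (τ.app X)) = R.rank i (τ.app (L.obj X)))
    {i : R.ι} (hi : ∀ j, R.rank j (τ.app (R.obj i)) = 0) :
    R.rank i (L.map (τ.app (R.obj i))) = 0 := by
  have hge (l : R.ι) : ∑ j, R.rank j (τ.app (R.obj l)) * R.rank l (𝟙 (L.obj (R.obj j))) ≤
      R.rank l (L.map (τ.app (R.obj l))) := by
    simpa using R.sum_rank_mul_le ((R.isRankFunction_rank l).map L) (τ.app (R.obj l))
  have heq (l : R.ι) : R.rank l (L.map (τ.app (R.obj l))) =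
      ∑ j, R.rank j (𝟙 (L.obj (R.obj l))) * R.rank l (τ.app (R.obj j)) := by
    rw [hLτ]
    simpa using R.sum_rank_mul_eq ((R.isRankFunction_rank l).map_comp_app τ)
      (𝟙 (L.obj (R.obj l))) (by simp)
  have htrace : ∑ l, ∑ j, R.rank j (τ.app (R.obj l)) * R.rank l (𝟙 (L.obj (R.obj j))) =
      ∑ l, R.rank l (L.map (τ.app (R.obj l))) := by
    simp_rw [heq]
    rw [Finset.sum_comm]
    simp_rw [mul_comm]
  have := (Finset.sum_eq_sum_iff_of_le fun l _ => hge l).1 htrace i (Finset.mem_univ i)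
  rw [← this]
  simp [hi]

end IndecRepresentatives

/-! ### Categories in which every morphism is von Neumann regular -/

section Regular

variable {C : Type*} [Category C]

/-- If every morphism `f` has a generalized inverse `g`, with `f ≫ g ≫ f = f`, kernels, cokernels
and normality come from splitting the idempotents `f ≫ g` and `g ≫ f`. -/
theorem exists_abelian_of_regular [P : Preadditive C] [HasFiniteBiproducts C]
    [IsIdempotentComplete C]
    (hreg : ∀ {X Y : C} (f : X ⟶ Y), ∃ g : Y ⟶ X, f ≫ g ≫ f = f) :
    ∃ A : Abelian C, A.toPreadditive = P := by
  have hker : HasKernels C := ⟨fun {X Y} f => by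
    obtain ⟨g, hg⟩ := hreg f
    obtain ⟨K, i, r, hir, hri⟩ := IsIdempotentComplete.idempotents_split X (𝟙 X - f ≫ g)
      (Idempotents.idem_of_id_sub_idem _ (by simp [reassoc_of% hg]))
    have hi : i ≫ f = 0 := by
      have : i ≫ (r ≫ i) ≫ f = 0 := by
        rw [hri]; simp [Preadditive.sub_comp, hg]
      simpa [reassoc_of% hir] using this
    exact ⟨⟨⟨KernelFork.ofι i hi, KernelFork.IsLimit.ofι i hi (fun x _ => x ≫ r)
      (fun x hx => by rw [Category.assoc, hri]; simp [reassoc_of% hx])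
      (fun x _ m hm => by rw [← hm, Category.assoc, hir, Category.comp_id])⟩⟩⟩⟩
  have hcoker : HasCokernels C := ⟨fun {X Y} f => by
    obtain ⟨g, hg⟩ := hreg f
    obtain ⟨Q, i, r, hir, hri⟩ := IsIdempotentComplete.idempotents_split Y (𝟙 Y - g ≫ f)
      (Idempotents.idem_of_id_sub_idem _ (by simp [hg]))
    have hr : f ≫ r = 0 := by
      have : f ≫ (r ≫ i) ≫ r = 0 := by
        rw [hri]; simp [Preadditive.sub_comp, reassoc_of% hg]
      simpa [hir] using this
    exact ⟨⟨⟨CokernelCofork.ofπ r hr, CokernelCofork.IsColimit.ofπ r hr (fun x _ => i ≫ x)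
      (fun x hx => by rw [← Category.assoc, hri]; simp [Preadditive.sub_comp, hx])
      (fun x _ m hm => by rw [← hm, reassoc_of% hir])⟩⟩⟩⟩
  have hmono : IsNormalMonoCategory C := ⟨fun {X Y} f _ => by
    obtain ⟨g, hg⟩ := hreg f
    have hfg : f ≫ g = 𝟙 X := by
      rw [← cancel_mono f]; simp [hg]
    exact ⟨⟨Y, 𝟙 Y - g ≫ f, by simp [reassoc_of% hfg], KernelFork.IsLimit.ofι f _
      (fun x _ => x ≫ g)
      (fun x hx => by
        rw [Preadditive.comp_sub, Category.comp_id, sub_eq_zero] at hx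
        rw [Category.assoc]; exact hx.symm)
      (fun x _ m hm => by rw [← hm, Category.assoc, hfg, Category.comp_id])⟩⟩⟩
  have hepi : IsNormalEpiCategory C := ⟨fun {X Y} f _ => by
    obtain ⟨g, hg⟩ := hreg f
    have hgf : g ≫ f = 𝟙 Y := by
      rw [← cancel_epi f]; simp [hg]
    exact ⟨⟨X, 𝟙 X - f ≫ g, by simp [Preadditive.sub_comp, hgf], CokernelCofork.IsColimit.ofπ f _
      (fun x _ => g ≫ x)
      (fun x hx => by
        rw [Preadditive.sub_comp, Category.id_comp, sub_eq_zero] at hx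
        rw [← Category.assoc]; exact hx.symm)
      (fun x _ m hm => by rw [← hm, reassoc_of% hgf])⟩⟩⟩
  exact ⟨{ toPreadditive := P
           toIsNormalMonoCategory := hmono
           toIsNormalEpiCategory := hepi
           has_finite_products := inferInstance }, rfl⟩

variable [Preadditive C]

/-- If monomorphisms split, a subobject of `X` is determined by the endomorphisms of `X` that
factor through it. -/
theorem finite_length_of_regular (k : Type*) [Field k] [Linear k C]
    (hreg : ∀ {X Y : C} (f : X ⟶ Y), ∃ g : Y ⟶ X, f ≫ g ≫ f = f) (X : C)
    [Module.Finite k (X ⟶ X)] : IsNoetherianObject X ∧ IsArtinianObject X := by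
  let Φ (A : Subobject X) : Submodule k (X ⟶ X) :=
    LinearMap.range (Linear.rightComp k X A.arrow)
  have hΦ (A B : Subobject X) : Φ A ≤ Φ B ↔ A ≤ B := by
    constructor
    · intro h
      obtain ⟨g, hg⟩ := hreg A.arrow
      obtain ⟨t, ht⟩ := h ⟨g, rfl⟩
      simp only [Linear.rightComp_apply] at ht
      exact Subobject.le_of_comm (A.arrow ≫ t) (by rw [Category.assoc, ht, hg])
    · rintro h _ ⟨t, rfl⟩
      exact ⟨t ≫ Subobject.ofLE A B h, by simp⟩
  let Ψ : Subobject X ↪o Submodule k (X ⟶ X) := OrderEmbedding.ofMapLEIff Φ hΦ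
  constructor
  · rw [isNoetherianObject_iff_not_strictMono]
    intro f hf
    exact not_strictMono_of_wellFoundedGT (Ψ ∘ f) (Ψ.strictMono.comp hf)
  · rw [isArtinianObject_iff_not_strictAnti]
    intro f hf
    exact not_strictAnti_of_wellFoundedLT (Ψ ∘ f) (Ψ.strictMono.comp_strictAnti hf)

theorem CategoryTheory.Indecomposable.simple_of_regular [HasFiniteBiproducts C]
    [IsIdempotentComplete C]
    (hreg : ∀ {X Y : C} (f : X ⟶ Y), ∃ g : Y ⟶ X, f ≫ g ≫ f = f) {S : C} (hS : Indecomposable S) :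
    Simple S where
  mono_isIso_iff_nonzero {Y} f _ := by
    constructor
    · rintro _ rfl
      apply hS.1
      rw [IsZero.iff_id_eq_zero, ← IsIso.inv_hom_id (0 : Y ⟶ S), comp_zero]
    · intro hf
      obtain ⟨g, hg⟩ := hreg f
      have hfg : f ≫ g = 𝟙 Y := by
        rw [← cancel_mono f]; simp [hg]
      exact hS.isIso_of_retract (fun hY => hf (hY.eq_of_src _ _)) hfg

end Regular

/-! ### Vanishing of the radical implies semisimplicity -/

namespace IndecRepresentatives

variable {k : Type*} [Field k] {C : Type*} [Category C] [Preadditive C] [HasFiniteBiproducts C]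
  [Linear k C] (R : IndecRepresentatives k C) [∀ X Y : C, Module.Finite k (X ⟶ Y)]
  [IsIdempotentComplete C]

/-- Splitting identities of indecomposables off `f` until the remainder is radical, hence zero. -/
theorem exists_generalized_inverse (hrad : ∀ X Y : C, R.radical X Y = ⊥) {X Y : C} (f : X ⟶ Y) :
    ∃ g : Y ⟶ X, f ≫ g ≫ f = f := by
  induction hn : ∑ j, R.rank j f * 1 using Nat.strong_induction_on generalizing f with
  | _ n ih =>
  by_cases h0 : ∃ j, R.rank j f ≠ 0
  · obtain ⟨j, hj⟩ := h0
    obtain ⟨a, b, hab⟩ := R.exists_factor hj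
    rw [R.sum_rank_eq_succ hab] at hn
    obtain ⟨h, hh⟩ := ih _ (by omega) (f - f ≫ b ≫ a ≫ f) rfl
    refine ⟨b ≫ a + (𝟙 Y - b ≫ a ≫ f) ≫ h ≫ (𝟙 X - f ≫ b ≫ a), ?_⟩
    have h1 : f ≫ (𝟙 Y - b ≫ a ≫ f) = f - f ≫ b ≫ a ≫ f := by simp
    have h2 : (𝟙 X - f ≫ b ≫ a) ≫ f = f - f ≫ b ≫ a ≫ f := by simp [Preadditive.sub_comp]
    rw [Preadditive.add_comp, Preadditive.comp_add, Category.assoc, Category.assoc,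
      Category.assoc, h2, ← Category.assoc f (𝟙 Y - _), h1, hh]
    abel
  · push Not at h0
    have : f = 0 := by
      rw [← Submodule.mem_bot k, ← hrad X Y]; exact h0
    exact ⟨0, by simp [this]⟩

/-- The Krull–Schmidt decomposition of the image of an idempotent, recorded by the inclusions `a`
and projections `b` so that no choice of an object splitting `e` is needed in the induction. -/
theorem exists_decomposition (R : IndecRepresentatives k C) {X : C} (e : X ⟶ X) (he : e ≫ e = e) :
    ∃ (J : Type) (_ : Fintype J) (_ : DecidableEq J) (S : J → C) (a : ∀ p, S p ⟶ X)
      (b : ∀ p, X ⟶ S p), (∀ p, Indecomposable (S p)) ∧ (∀ p, a p ≫ b p = 𝟙 _) ∧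
      (∀ p q, p ≠ q → a p ≫ b q = 0) ∧ ∑ p, b p ≫ a p = e := by
  induction hn : ∑ j, R.rank j e * 1 using Nat.strong_induction_on generalizing e with
  | _ n ih =>
  by_cases h0 : ∃ j, R.rank j e ≠ 0
  · obtain ⟨j, hj⟩ := h0
    obtain ⟨a₀, b₀, hab₀⟩ := R.exists_factor hj
    rw [R.sum_rank_eq_succ hab₀] at hn
    obtain ⟨J, _, _, S, a, b, hS, hd, ho, hsum⟩ :=
      ih _ (by omega) _ (idempotent_sub_retract he hab₀) rfl
    have ha (p : J) : a p ≫ (e - e ≫ b₀ ≫ a₀ ≫ e) = a p := by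
      rw [← hsum, Preadditive.comp_sum, Finset.sum_eq_single p]
      · rw [reassoc_of% hd p]
      · intro q _ hq
        rw [reassoc_of% ho p q hq.symm, zero_comp]
      · simp
    have hb (p : J) : (e - e ≫ b₀ ≫ a₀ ≫ e) ≫ b p = b p := by
      rw [← hsum, Preadditive.sum_comp, Finset.sum_eq_single p]
      · rw [Category.assoc, hd p, Category.comp_id]
      · intro q _ hq
        rw [Category.assoc, ho q p hq, comp_zero]
      · simp
    refine ⟨Option J, inferInstance, inferInstance, fun p => p.elim (R.obj j) S,
      fun p => match p with | none => a₀ ≫ e | some p => a p,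
      fun p => match p with | none => e ≫ b₀ | some p => b p, ?_, ?_, ?_, ?_⟩
    · rintro (_ | p)
      exacts [R.indecomposable j, hS p]
    · rintro (_ | p)
      · simpa [reassoc_of% he] using hab₀
      · exact hd p
    · rintro (_ | p) (_ | q) hpq
      · exact absurd rfl hpq
      · change (a₀ ≫ e) ≫ b q = 0
        rw [← hb q]
        simp [Preadditive.sub_comp, reassoc_of% he, reassoc_of% hab₀]
      · change a p ≫ e ≫ b₀ = 0
        rw [← ha p]
        simp [Preadditive.sub_comp, reassoc_of% he, hab₀]
      · exact ho p q fun h => hpq (by rw [h])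
    · rw [Fintype.sum_option]
      change (e ≫ b₀) ≫ a₀ ≫ e + ∑ p, b p ≫ a p = e
      rw [hsum]
      simp
  · have he0 : e = 0 := by
      by_contra hne
      exact h0 (R.exists_rank_ne_zero he hne)
    exact ⟨Empty, inferInstance, inferInstance, fun p => p.elim, fun p => p.elim,
      fun p => p.elim, fun p => p.elim, fun p => p.elim, fun p => p.elim, by simp [he0]⟩

theorem isSemisimpleCategory (hrad : ∀ X Y : C, R.radical X Y = ⊥) : IsSemisimpleCategory C where
  abelian := exists_abelian_of_regular (R.exists_generalized_inverse hrad)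
  sum_of_simples X := by
    obtain ⟨J, _, _, S, a, b, hS, hd, ho, hsum⟩ := R.exists_decomposition (𝟙 X) (by simp)
    let t : Bicone S :=
      { pt := X
        π := b
        ι := a
        ι_π := fun p q => by
          split_ifs with h
          · subst h; simp [hd]
          · exact ho p q h }
    let ψ : X ≅ ⨁ S := biproduct.uniqueUpToIso S (isBilimitOfTotal t hsum)
    let σ := (Fintype.equivFin J).symm
    exact ⟨_, S ∘ σ, fun i => (hS _).simple_of_regular (R.exists_generalized_inverse hrad),
      ⟨ψ ≪≫ (biproduct.whiskerEquiv σ fun _ => Iso.refl _).symm⟩⟩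

end IndecRepresentatives

/-! ### The radical is stable under whiskering -/

section Whiskering

variable {k : Type*} [Field k] {B : Type u} [Bicategory.{w, v} B]
  [∀ a b : B, Preadditive (a ⟶ b)] [∀ a b : B, Linear k (a ⟶ b)]

theorem HorizontalBilinear.additive_precomp (hB : HorizontalBilinear k B) {a b : B} (c : B)
    (f : a ⟶ b) : (Bicategory.precomp c f).Additive where
  map_add {_ _ η θ} := hB.whiskerLeft_add f η θ

theorem HorizontalBilinear.additive_postcomp (hB : HorizontalBilinear k B) {b c : B} (a : B)
    (f : b ⟶ c) : (Bicategory.postcomp a f).Additive where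
  map_add {_ _ η θ} := hB.add_whiskerRight η θ f

variable [∀ a b : B, HasFiniteBiproducts (a ⟶ b)] {a : B} [∀ X Y : a ⟶ a, Module.Finite k (X ⟶ Y)]
  [IsIdempotentComplete (a ⟶ a)] (R : IndecRepresentatives k (a ⟶ a))

namespace IndecRepresentatives

/-- If `𝟙 a` is a retract of some `G ≫ S` for every indecomposable `S`, the radical is stable under
left whiskering: by the trace argument the identity of `𝟙 a` never factors through `K ◁ f`, and an
identity of `S` factoring through `H ◁ f` would give one of `𝟙 a` factoring through `(G ≫ H) ◁ f`.
-/
theorem whiskerLeft_mem_radical (hB : HorizontalBilinear k B) (hid : Indecomposable (𝟙 a))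
    (hcell : ∀ S : a ⟶ a, Indecomposable S →
      ∃ (G : a ⟶ a) (u : 𝟙 a ⟶ G ≫ S) (v : G ≫ S ⟶ 𝟙 a), u ≫ v = 𝟙 (𝟙 a))
    (H : a ⟶ a) {X Y : a ⟶ a} {f : X ⟶ Y} (hf : f ∈ R.radical X Y) :
    H ◁ f ∈ R.radical (H ≫ X) (H ≫ Y) := by
  obtain ⟨i, ⟨e⟩⟩ := R.exists_iso (𝟙 a) hid
  -- composing with the representative of `𝟙 a` changes a morphism only up to isomorphism
  let φ (Z : a ⟶ a) : R.obj i ≫ Z ≅ Z := Bicategory.whiskerRightIso e.symm Z ≪≫ λ_ Z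
  have hφ : R.obj i ◁ f ≫ (φ Y).hom = (φ X).hom ≫ f := by
    simp [φ, Bicategory.whisker_exchange_assoc]
  have hone (j : R.ι) : R.rank j (R.obj i ◁ f) = R.rank j f :=
    (R.isRankFunction_rank j).eq_of_iso (φ X) (φ Y) _ _ hφ
  have key (K : a ⟶ a) : R.rank i (K ◁ f) = 0 := by
    have := hB.additive_precomp a K
    have : ((Bicategory.postcomposing a a a).obj X).Additive := hB.additive_postcomp a X
    have : ((Bicategory.postcomposing a a a).obj Y).Additive := hB.additive_postcomp a Y
    have h0 : R.rank i (K ◁ (R.obj i ◁ f)) = 0 :=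
      R.rank_map_app_eq_zero (Bicategory.precomp a K) ((Bicategory.postcomposing a a a).map f)
        (fun l G => (R.isRankFunction_rank l).eq_of_iso (α_ K G X).symm (α_ K G Y).symm _ _
          (Bicategory.associator_inv_naturality_right K G f)) (fun j => (hone j).trans (hf j))
    rw [← h0]
    refine ((R.isRankFunction_rank i).eq_of_iso (Bicategory.whiskerLeftIso K (φ X))
      (Bicategory.whiskerLeftIso K (φ Y)) _ _ ?_).symm
    simp only [Bicategory.whiskerLeftIso_hom]
    rw [← Bicategory.whiskerLeft_comp, hφ, Bicategory.whiskerLeft_comp]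
  intro j
  by_contra hj
  obtain ⟨p, q, hpq⟩ := R.exists_factor hj
  obtain ⟨G, s, t, hst⟩ := hcell _ (R.indecomposable j)
  refine R.rank_ne_zero_of_factor (f := (G ≫ H) ◁ f)
    (a := e.inv ≫ s ≫ G ◁ p ≫ (α_ G H X).inv) (b := (α_ G H Y).hom ≫ G ◁ q ≫ t ≫ e.hom) ?_ (key _)
  have : G ◁ p ≫ G ◁ (H ◁ f) ≫ G ◁ q = 𝟙 _ := by
    rw [← Bicategory.whiskerLeft_comp, ← Bicategory.whiskerLeft_comp, hpq,
      Bicategory.whiskerLeft_id]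
  simp [reassoc_of% this, reassoc_of% hst]

/-- The mirror image of `whiskerLeft_mem_radical`. -/
theorem whiskerRight_mem_radical (hB : HorizontalBilinear k B) (hid : Indecomposable (𝟙 a))
    (hcell : ∀ S : a ⟶ a, Indecomposable S →
      ∃ (G : a ⟶ a) (u : 𝟙 a ⟶ S ≫ G) (v : S ≫ G ⟶ 𝟙 a), u ≫ v = 𝟙 (𝟙 a))
    (H : a ⟶ a) {X Y : a ⟶ a} {f : X ⟶ Y} (hf : f ∈ R.radical X Y) :
    f ▷ H ∈ R.radical (X ≫ H) (Y ≫ H) := by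
  obtain ⟨i, ⟨e⟩⟩ := R.exists_iso (𝟙 a) hid
  -- composing with the representative of `𝟙 a` changes a morphism only up to isomorphism
  let φ (Z : a ⟶ a) : Z ≫ R.obj i ≅ Z := Bicategory.whiskerLeftIso Z e.symm ≪≫ ρ_ Z
  have hφ : f ▷ R.obj i ≫ (φ Y).hom = (φ X).hom ≫ f := by
    simp [φ, ← Bicategory.whisker_exchange_assoc]
  have hone (j : R.ι) : R.rank j (f ▷ R.obj i) = R.rank j f :=
    (R.isRankFunction_rank j).eq_of_iso (φ X) (φ Y) _ _ hφ
  have key (K : a ⟶ a) : R.rank i (f ▷ K) = 0 := by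
    have := hB.additive_postcomp a K
    have : ((Bicategory.precomposing a a a).obj X).Additive := hB.additive_precomp a X
    have : ((Bicategory.precomposing a a a).obj Y).Additive := hB.additive_precomp a Y
    have h0 : R.rank i ((f ▷ R.obj i) ▷ K) = 0 :=
      R.rank_map_app_eq_zero (Bicategory.postcomp a K) ((Bicategory.precomposing a a a).map f)
        (fun l G => (R.isRankFunction_rank l).eq_of_iso (α_ X G K) (α_ Y G K) _ _
          (Bicategory.associator_naturality_left f G K)) (fun j => (hone j).trans (hf j))
    rw [← h0]
    refine ((R.isRankFunction_rank i).eq_of_iso (Bicategory.whiskerRightIso (φ X) K)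
      (Bicategory.whiskerRightIso (φ Y) K) _ _ ?_).symm
    simp only [Bicategory.whiskerRightIso_hom]
    rw [← Bicategory.comp_whiskerRight, hφ, Bicategory.comp_whiskerRight]
  intro j
  by_contra hj
  obtain ⟨p, q, hpq⟩ := R.exists_factor hj
  obtain ⟨G, s, t, hst⟩ := hcell _ (R.indecomposable j)
  refine R.rank_ne_zero_of_factor (f := f ▷ (H ≫ G))
    (a := e.inv ≫ s ≫ p ▷ G ≫ (α_ X H G).hom) (b := (α_ Y H G).inv ≫ q ▷ G ≫ t ≫ e.hom) ?_ (key _)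
  have : p ▷ G ≫ (f ▷ H) ▷ G ≫ q ▷ G = 𝟙 _ := by
    rw [← Bicategory.comp_whiskerRight, ← Bicategory.comp_whiskerRight, hpq,
      Bicategory.id_whiskerRight]
  simp [reassoc_of% this, reassoc_of% hst]

end IndecRepresentatives

end Whiskering

/-! ### Consequences of having a single cell -/

section Cells

variable {B : Type u} [Bicategory.{w, v} B] [∀ a b : B, Preadditive (a ⟶ b)]
  [∀ a b : B, HasFiniteBiproducts (a ⟶ b)]

theorem IsSummand.exists_retract {a b : B} {X Y : a ⟶ b} (h : IsSummand X Y) :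
    ∃ (u : X ⟶ Y) (v : Y ⟶ X), u ≫ v = 𝟙 X := by
  obtain ⟨Z, ⟨φ⟩⟩ := h
  exact ⟨biprod.inl ≫ φ.inv, φ.hom ≫ biprod.fst, by simp⟩

/-- The generating relation of the left preorder is already transitive, up to passing from direct
summands to retracts. -/
theorem LeftLE.exists_retract {a b c : B} {S : a ⟶ b} {T : a ⟶ c} {hS : Indecomposable S}
    {hT : Indecomposable T} (h : LeftLE ⟨S, hS⟩ ⟨T, hT⟩) :
    ∃ (G : b ⟶ c) (u : T ⟶ S ≫ G) (v : S ≫ G ⟶ T), u ≫ v = 𝟙 T := by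
  suffices ∀ F : IndecOneMor B, LeftLE ⟨S, hS⟩ F → ∃ (d : B) (T' : a ⟶ d) (hT' : Indecomposable T')
      (G : b ⟶ d) (u : T' ⟶ S ≫ G) (v : S ≫ G ⟶ T'), F = ⟨T', hT'⟩ ∧ u ≫ v = 𝟙 T' by
    obtain ⟨d, T', hT', G, u, v, hF, huv⟩ := this _ h
    cases hF
    exact ⟨G, u, v, huv⟩
  intro F hF
  induction hF with
  | refl => exact ⟨b, S, hS, 𝟙 b, (ρ_ S).inv, (ρ_ S).hom, rfl, by simp⟩
  | tail _ hgen ih =>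
    obtain ⟨d, T', hT', G, u, v, rfl, huv⟩ := ih
    cases hgen with
    | mk _ hG' H hH =>
      obtain ⟨s, t, hst⟩ := hH.exists_retract
      refine ⟨_, _, hG', G ≫ H, s ≫ u ▷ H ≫ (α_ _ _ _).hom, (α_ _ _ _).inv ≫ v ▷ H ≫ t, rfl, ?_⟩
      have : u ▷ H ≫ v ▷ H = 𝟙 _ := by
        rw [← Bicategory.comp_whiskerRight, huv, Bicategory.id_whiskerRight]
      simp [reassoc_of% this, hst]

/-- The mirror image of `LeftLE.exists_retract`. -/
theorem RightLE.exists_retract {a b c : B} {S : b ⟶ c} {T : a ⟶ c} {hS : Indecomposable S}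
    {hT : Indecomposable T} (h : RightLE ⟨S, hS⟩ ⟨T, hT⟩) :
    ∃ (G : a ⟶ b) (u : T ⟶ G ≫ S) (v : G ≫ S ⟶ T), u ≫ v = 𝟙 T := by
  suffices ∀ F : IndecOneMor B, RightLE ⟨S, hS⟩ F → ∃ (d : B) (T' : d ⟶ c) (hT' : Indecomposable T')
      (G : d ⟶ b) (u : T' ⟶ G ≫ S) (v : G ≫ S ⟶ T'), F = ⟨T', hT'⟩ ∧ u ≫ v = 𝟙 T' by
    obtain ⟨d, T', hT', G, u, v, hF, huv⟩ := this _ h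
    cases hF
    exact ⟨G, u, v, huv⟩
  intro F hF
  induction hF with
  | refl => exact ⟨b, S, hS, 𝟙 b, (λ_ S).inv, (λ_ S).hom, rfl, by simp⟩
  | tail _ hgen ih =>
    obtain ⟨d, T', hT', G, u, v, rfl, huv⟩ := ih
    cases hgen with
    | mk _ hG' H hH =>
      obtain ⟨s, t, hst⟩ := hH.exists_retract
      refine ⟨_, _, hG', H ≫ G, s ≫ H ◁ u ≫ (α_ _ _ _).inv, (α_ _ _ _).hom ≫ H ◁ v ≫ t, rfl, ?_⟩
      have : H ◁ u ≫ H ◁ v = 𝟙 _ := by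
        rw [← Bicategory.whiskerLeft_comp, huv, Bicategory.whiskerLeft_id]
      simp [reassoc_of% this, hst]

/-- The `H`-cell of `F` is the intersection of its left and right cells; if there is only one
`H`-cell, it contains every indecomposable 1-morphism, and all of them are equivalent. -/
theorem mem_hCell_of_unique {H₀ : Set (IndecOneMor B)}
    (hH₀ : ∀ S : Set (IndecOneMor B), IsHCell S ↔ S = H₀) (F : IndecOneMor B) :
    H₀ = {G | LeftLE F G ∧ LeftLE G F} ∩ {G | RightLE F G ∧ RightLE G F} ∧ F ∈ H₀ := by
  have hF : F ∈ {G | LeftLE F G ∧ LeftLE G F} ∩ {G | RightLE F G ∧ RightLE G F} :=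
    ⟨⟨.refl, .refl⟩, ⟨.refl, .refl⟩⟩
  have h := (hH₀ _).1 ⟨⟨F, hF⟩, _, _, ⟨F, rfl⟩, ⟨F, rfl⟩, rfl⟩
  exact ⟨h.symm, h ▸ hF⟩

end Cells

/-- The radical is a 2-ideal without identities of indecomposable 1-morphisms, so it is zero. -/
theorem radical_eq_bot_of_isCellSimple {k : Type*} [Field k]
    {B : Type u} [Bicategory.{w, v} B] [Subsingleton B]
    [∀ a b : B, Preadditive (a ⟶ b)] [∀ a b : B, Linear k (a ⟶ b)]
    [∀ a b : B, HasFiniteBiproducts (a ⟶ b)]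
    (hB : IsFinitaryBicategory k B)
    (R : ∀ a b : B, IndecRepresentatives k (a ⟶ b))
    (H₀ : Set (IndecOneMor B)) (hH₀ : ∀ S : Set (IndecOneMor B), IsHCell S ↔ S = H₀)
    (hsimple : IsCellSimple k H₀) (a : B) (X Y : a ⟶ a) :
    haveI := (hB.finitary_hom a a).finite_hom
    (R a a).radical X Y = ⊥ := by
  have hfin (a b : B) := (hB.finitary_hom a b).finite_hom
  have hidem (a b : B) := (hB.finitary_hom a b).idempotentComplete
  have hcell (a : B) (S : a ⟶ a) (hS : Indecomposable S) :=
    (mem_hCell_of_unique hH₀ ⟨S, hS⟩).1 ▸ (mem_hCell_of_unique hH₀ ⟨𝟙 a, hB.indecomposable_id a⟩).2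
  let I : TwoIdeal k B :=
    { carrier := fun {a b} => (R a b).radical
      precomp_mem := fun {a b _ _ _} η {θ} h => by
        simpa using (R a b).comp_mem_radical η (𝟙 _) h
      postcomp_mem := fun {a b _ _ _ η} θ h => by
        simpa using (R a b).comp_mem_radical (𝟙 _) θ h
      whiskerLeft_mem := fun {a b c} f g h η hη => by
        obtain rfl : a = b := Subsingleton.elim _ _
        obtain rfl : a = c := Subsingleton.elim _ _
        exact (R a a).whiskerLeft_mem_radical hB.bilinear (hB.indecomposable_id a)
          (fun S hS => (hcell a S hS).2.1.exists_retract) f hη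
      whiskerRight_mem := fun {a b c} f g η h hη => by
        obtain rfl : a = b := Subsingleton.elim _ _
        obtain rfl : a = c := Subsingleton.elim _ _
        exact (R a a).whiskerRight_mem_radical hB.bilinear (hB.indecomposable_id a)
          (fun S hS => (hcell a S hS).1.1.exists_retract) h hη }
  rw [eq_bot_iff]
  intro f hf
  by_contra hne
  have h1 : 𝟙 (𝟙 a) ∈ (R a a).radical (𝟙 a) (𝟙 a) :=
    hsimple I ⟨a, a, X, Y, f, hf, hne⟩ _
      (mem_hCell_of_unique hH₀ ⟨𝟙 a, hB.indecomposable_id a⟩).2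
  obtain ⟨i, hi⟩ := (R a a).exists_factor_of_indecomposable (hB.indecomposable_id a)
    (f := 𝟙 (𝟙 a)) (a := 𝟙 _) (b := 𝟙 _) (by simp)
  exact hi (h1 i)

theorem mainTheorem2 {k : Type*} [Field k] [IsAlgClosed k]
    {B : Type u} [Bicategory.{w, v} B]
    [∀ a b : B, Preadditive (a ⟶ b)] [∀ a b : B, Linear k (a ⟶ b)]
    [∀ a b : B, HasFiniteBiproducts (a ⟶ b)]
    (hB : IsQuasiFiab k B) (hone : Nonempty (Unique B))
    (H₀ : Set (IndecOneMor B)) (hH₀ : ∀ S : Set (IndecOneMor B), IsHCell S ↔ S = H₀)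
    (hsimple : IsCellSimple k H₀) :
    IsFusion k B := by
  obtain ⟨_⟩ := id hone
  have hfin (a b : B) := (hB.finitary_hom a b).finite_hom
  have hidem (a b : B) := (hB.finitary_hom a b).idempotentComplete
  let R (a b : B) := Classical.choice ((hB.finitary_hom a b).nonempty_indecRepresentatives k)
  have hrad (a : B) :=
    radical_eq_bot_of_isCellSimple hB.toIsFinitaryBicategory R H₀ hH₀ hsimple a
  exact
    { one_object := hone
      finite_indecomposables := fun a => (hB.finitary_hom a a).finite_indecomposables
      semisimple := fun a => (R a a).isSemisimpleCategory (hrad a)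
      finite_length := fun a X =>
        finite_length_of_regular k ((R a a).exists_generalized_inverse (hrad a)) X
      finite_hom := fun a => hfin a a
      bilinear := hB.bilinear
      indecomposable_id := hB.indecomposable_id
      hasRightAdjoint := fun _ X => hB.hasRightAdjoint X
      hasLeftAdjoint := fun _ X => hB.hasLeftAdjoint X }
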